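/- For $n\ge 0$ let $a_n$ be the number of palindromic squares $k^2$ (with $k\ge 0$ an integer) having exactly $n+1$ decimal digits and such that $k$ is also a palindrome. Palindromes are taken in base ten, and $0$ is a palindrome with one digit. (This is the sequence A307717 of the OEIS, with $a_n$ its $(n+1)$-st term.) Then \[ a_0 = 4, \qquad a_{2n+1} = 0 \quad (n\ge 0), \] \[ a_{2n} = \frac{\left((-1)^n+3\right)n^3-\left(9(-1)^n+15\right)n^2+\left(65(-1)^n+111\right)n+21(-1)^n+171}{96} \quad (n\ge 1). \] -/

import Mathlib

/-- The decimal expansion of a natural number, least significant digit first.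
The number `0` is written with the single digit `0`, so it has length one
(`Nat.digits 10 0` is the empty list). -/
def decimalDigits (m : ℕ) : List ℕ :=
  if m = 0 then [0] else Nat.digits 10 m

/-- The number of decimal digits of `m`. -/
def decimalLength (m : ℕ) : ℕ :=
  (decimalDigits m).length

/-- `m` reads the same in both directions in base ten. -/
def IsDecimalPalindrome (m : ℕ) : Prop :=
  (decimalDigits m).reverse = decimalDigits m

/-- The palindromic squares `k ^ 2` with exactly `l` decimal digits such that `k` is also
a palindrome. -/
def palindromicSquares (l : ℕ) : Set ℕ :=
  {m : ℕ | decimalLength m = l ∧ IsDecimalPalindrome m ∧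
    ∃ k : ℕ, IsDecimalPalindrome k ∧ m = k ^ 2}

/-- There are finitely many such squares of a given length, so that `Set.ncard` below
really counts them. -/
theorem palindromicSquares_finite (l : ℕ) : (palindromicSquares l).Finite := by
  refine (Set.finite_lt_nat (10 ^ l)).subset ?_
  rintro m ⟨hm, -, -⟩
  show m < 10 ^ l
  by_cases h : m = 0
  · subst h
    positivity
  · have h2 : m < 10 ^ (Nat.digits 10 m).length := Nat.lt_base_pow_length_digits (by norm_num)
    simp only [decimalLength, decimalDigits, if_neg h] at hm
    rwa [hm] at h2

/-- The term of index `n`, starting from `0`: the number of palindromic squares `k ^ 2` of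
length `n + 1` such that `k` is also a palindrome. -/
noncomputable def a307717 (n : ℕ) : ℕ :=
  (palindromicSquares (n + 1)).ncard

/-! Both `k` and `k ^ 2` are palindromes exactly when `k` is a palindrome and squaring it involves
no carries, i.e. when its digits have squares summing to at most 9. Let `L` be the digit list of a
palindrome `k` and `convSquare L` the coefficients of the squared digit polynomial: a palindromic
list with value `k ^ 2`. If `k ^ 2` is a palindrome, its digit list has the same length
(`decimalLength_sq`), and two such lists with equal value coincide
(`Nat.eq_of_ofDigits_eq_of_reverse_eq`); so the middle coefficient, which is the sum of the squared
digits, is a digit. Conversely that sum bounds every coefficient, so if it is at most 9 nothing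
carries.

It remains to count palindromic lists with nonzero first entry and square sum at most 9. Peeling off
outer pairs gives Pascal-type recursions, hence binomial coefficients in half the length; the parity
of the length accounts for the sign in the formula. -/

theorem Nat.ofDigits_cons_eq {R : Type*} [Semiring R] (b : R) (x : ℕ) (L : List ℕ) :
    Nat.ofDigits b (x :: L) = x + b * Nat.ofDigits b L := rfl

open Polynomial in
theorem Polynomial.coeff_ofDigits_X (L : List ℕ) (i : ℕ) :
    (Nat.ofDigits (X : ℕ[X]) L).coeff i = L.getD i 0 := by
  induction L generalizing i with
  | nil => simp [Nat.ofDigits]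
  | cons x L ih =>
    rw [Nat.ofDigits_cons_eq]
    cases i with
    | zero => simp
    | succ i =>
      rw [coeff_add, coeff_X_mul, ih]
      simp [coeff_natCast_ite]

open Polynomial in
theorem Polynomial.eval_ofDigits_X (L : List ℕ) (b : ℕ) :
    (Nat.ofDigits (X : ℕ[X]) L).eval b = Nat.ofDigits b L := by
  induction L with
  | nil => simp [Nat.ofDigits]
  | cons x L ih => simp [Nat.ofDigits_cons_eq, ih]

theorem Nat.ofDigits_map_range (f : ℕ → ℕ) (b n : ℕ) :
    Nat.ofDigits b ((List.range n).map f) = ∑ i ∈ Finset.range n, f i * b ^ i := by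
  induction n with
  | zero => simp
  | succ n ih =>
    rw [List.range_succ, List.map_append, Nat.ofDigits_append, ih, Finset.sum_range_succ]
    simp [mul_comm]

theorem List.exists_eq_cons_append_of_reverse_eq {α : Type*} {L : List α} {n : ℕ}
    (hL : L.reverse = L) (hn : L.length = n + 2) :
    ∃ x M, L = x :: (M ++ [x]) ∧ M.reverse = M ∧ M.length = n := by
  rcases L with _ | ⟨x, T⟩
  · simp at hn
  rcases List.eq_nil_or_concat T with rfl | ⟨M, y, rfl⟩
  · simp at hn
  simp only [List.concat_eq_append, List.reverse_cons, List.reverse_append, List.reverse_nil,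
    List.nil_append, List.cons_append, List.cons.injEq] at hL
  obtain ⟨rfl, h⟩ := hL
  refine ⟨y, M, by simp, List.append_cancel_right h, by simpa using hn⟩

/-- A palindromic list whose value equals that of a palindromic list of digits of the same
length is that list of digits. -/
theorem Nat.eq_of_ofDigits_eq_of_reverse_eq {n : ℕ} {C Y : List ℕ} (hC : C.length = n)
    (hY : Y.length = n) (rC : C.reverse = C) (rY : Y.reverse = Y) (hlt : ∀ y ∈ Y, y < 10)
    (h : Nat.ofDigits 10 C = Nat.ofDigits 10 Y) : C = Y := by
  induction n using Nat.twoStepInduction generalizing C Y with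
  | zero => rw [List.length_eq_zero_iff.1 hC, List.length_eq_zero_iff.1 hY]
  | one =>
    obtain ⟨a, rfl⟩ := List.length_eq_one_iff.1 hC
    obtain ⟨b, rfl⟩ := List.length_eq_one_iff.1 hY
    simpa using h
  | more n ih _ =>
    obtain ⟨a, C, rfl, rC', hC'⟩ := List.exists_eq_cons_append_of_reverse_eq rC hC
    obtain ⟨b, Y, rfl, rY', hY'⟩ := List.exists_eq_cons_append_of_reverse_eq rY hY
    have hY10 := Nat.ofDigits_lt_base_pow_length (b := 10) (by norm_num) hlt
    have hb : b < 10 := hlt b (by simp)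
    rw [← h, hY] at hY10
    simp only [Nat.ofDigits_cons, Nat.ofDigits_append, Nat.ofDigits_nil, hC', hY',
      mul_zero, add_zero] at h hY10
    -- Only `Y` is assumed to consist of digits; the entry `a` is bounded because it is also the
    -- leading coefficient.
    have ha : a < 10 := by
      have h1 : 10 ^ (n + 1) * a < 10 ^ (n + 1) * 10 := by
        rw [← pow_succ]
        refine lt_of_le_of_lt ?_ hY10
        rw [pow_succ]
        nlinarith [Nat.zero_le (Nat.ofDigits 10 C)]
      exact lt_of_mul_lt_mul_left h1 (Nat.zero_le _)
    have hab : a = b := by omega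
    subst hab
    rw [ih hC' hY' rC' rY' (fun y hy => hlt y (by simp [hy])) (by omega)]

/-! ### Convolution squares: symmetry and size of the coefficients -/

theorem List.sum_range_getD_sq_le (L : List ℕ) (n : ℕ) :
    ∑ i ∈ Finset.range n, L.getD i 0 ^ 2 ≤ (L.map (· ^ 2)).sum := by
  induction L generalizing n with
  | nil => simp
  | cons x L ih =>
    cases n with
    | zero => simp
    | succ n =>
      rw [Finset.sum_range_succ']
      have := ih n
      simp only [List.getD_cons_succ, List.getD_cons_zero, List.map_cons, List.sum_cons]
      omega

theorem List.sum_range_length_getD_sq (L : List ℕ) :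
    ∑ i ∈ Finset.range L.length, L.getD i 0 ^ 2 = (L.map (· ^ 2)).sum := by
  induction L with
  | nil => simp
  | cons x L ih =>
    rw [List.length_cons, Finset.sum_range_succ']
    simp only [List.getD_cons_succ, List.getD_cons_zero, List.map_cons, List.sum_cons, ih]
    omega

/-- The convolution square of a list `L` of numbers, as a list of length `2 * L.length - 1`. -/
noncomputable def convSquare (L : List ℕ) : List ℕ :=
  (List.range (2 * L.length - 1)).map ((Nat.ofDigits (Polynomial.X : Polynomial ℕ) L) ^ 2).coeff

theorem length_convSquare (L : List ℕ) : (convSquare L).length = 2 * L.length - 1 := by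
  simp [convSquare]

open Polynomial in
theorem natDegree_ofDigits_X_le (L : List ℕ) :
    (Nat.ofDigits (X : ℕ[X]) L).natDegree ≤ L.length - 1 := by
  rw [natDegree_le_iff_coeff_eq_zero]
  intro i hi
  rw [coeff_ofDigits_X, List.getD_eq_default _ _ (by omega)]

open Polynomial in
theorem ofDigits_convSquare {L : List ℕ} (hL : L ≠ []) :
    Nat.ofDigits 10 (convSquare L) = Nat.ofDigits 10 L ^ 2 := by
  have hpos := List.length_pos_iff.2 hL
  rw [convSquare, Nat.ofDigits_map_range, ← eval_eq_sum_range', eval_pow, eval_ofDigits_X]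
  have h1 := natDegree_ofDigits_X_le L
  have h2 := natDegree_pow_le (p := Nat.ofDigits (X : ℕ[X]) L) (n := 2)
  omega

theorem List.getD_of_reverse_eq {L : List ℕ} (rL : L.reverse = L) {i : ℕ} (hi : i < L.length) :
    L.getD (L.length - 1 - i) 0 = L.getD i 0 := by
  conv_rhs => rw [← rL]
  rw [List.getD_reverse _ hi]

open Polynomial in
-- Reflection of polynomials is multiplicative, so the square of a self-reciprocal polynomial is
-- self-reciprocal.
theorem reverse_convSquare {L : List ℕ} (rL : L.reverse = L) :
    (convSquare L).reverse = convSquare L := by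
  set p := Nat.ofDigits (X : ℕ[X]) L with hp
  have hdeg := natDegree_ofDigits_X_le L
  have hrefl : reflect (L.length - 1) p = p := by
    ext i
    rw [coeff_reflect, hp, coeff_ofDigits_X, coeff_ofDigits_X]
    by_cases hi : i ≤ L.length - 1
    · rw [revAt_le hi]
      by_cases h0 : L.length = 0
      · rw [List.length_eq_zero_iff.1 h0]; simp
      · exact List.getD_of_reverse_eq rL (by omega)
    · rw [revAt_eq_self_of_lt (by omega)]
  have hsq : reflect (2 * L.length - 1 - 1) (p ^ 2) = p ^ 2 := by
    have := reflect_mul p p hdeg hdeg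
    rw [hrefl, ← sq] at this
    rwa [show 2 * L.length - 1 - 1 = L.length - 1 + (L.length - 1) by omega]
  refine List.ext_getElem (by simp) fun i h1 h2 => ?_
  rw [length_convSquare] at h2
  rw [List.getElem_reverse]
  simp only [convSquare, List.getElem_map, List.getElem_range, List.length_map, List.length_range]
  rw [← hp]
  conv_rhs => rw [← hsq, coeff_reflect, revAt_le (by omega)]

open Polynomial in
-- Apply `2ab ≤ a² + b²` to each product; either index runs over distinct positions of `L`.
theorem coeff_sq_ofDigits_X_le (L : List ℕ) (j : ℕ) :
    ((Nat.ofDigits (X : ℕ[X]) L) ^ 2).coeff j ≤ (L.map (· ^ 2)).sum := by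
  rw [sq, coeff_mul]
  simp only [coeff_ofDigits_X]
  have h1 : ∑ x ∈ Finset.HasAntidiagonal.antidiagonal j, L.getD x.1 0 ^ 2 ≤ (L.map (· ^ 2)).sum := by
    rw [Finset.Nat.sum_antidiagonal_eq_sum_range_succ (fun a _ => L.getD a 0 ^ 2)]
    exact List.sum_range_getD_sq_le L _
  have h2 : ∑ x ∈ Finset.HasAntidiagonal.antidiagonal j, L.getD x.2 0 ^ 2 ≤ (L.map (· ^ 2)).sum := by
    rw [← Finset.Nat.sum_antidiagonal_swap]
    exact h1
  have h3 : 2 * ∑ x ∈ Finset.HasAntidiagonal.antidiagonal j, L.getD x.1 0 * L.getD x.2 0 ≤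
      ∑ x ∈ Finset.HasAntidiagonal.antidiagonal j, (L.getD x.1 0 ^ 2 + L.getD x.2 0 ^ 2) := by
    rw [Finset.mul_sum]
    refine Finset.sum_le_sum fun x _ => ?_
    rw [← mul_assoc]
    exact two_mul_le_add_sq _ _
  rw [Finset.sum_add_distrib] at h3
  omega

open Polynomial in
-- The middle coefficient pairs each entry with its mirror image, which is equal to it.
theorem coeff_sq_ofDigits_X_middle {L : List ℕ} (rL : L.reverse = L) (hL : L ≠ []) :
    ((Nat.ofDigits (X : ℕ[X]) L) ^ 2).coeff (L.length - 1) = (L.map (· ^ 2)).sum := by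
  have hpos := List.length_pos_iff.2 hL
  rw [sq, coeff_mul, Finset.Nat.sum_antidiagonal_eq_sum_range_succ_mk,
    ← List.sum_range_length_getD_sq, Nat.succ_eq_add_one, Nat.sub_add_cancel hpos]
  refine Finset.sum_congr rfl fun i hi => ?_
  rw [coeff_ofDigits_X, coeff_ofDigits_X, List.getD_of_reverse_eq rL (Finset.mem_range.1 hi), sq]

theorem sum_sq_mem_convSquare {L : List ℕ} (rL : L.reverse = L) (hL : L ≠ []) :
    (L.map (· ^ 2)).sum ∈ convSquare L := by
  have hpos := List.length_pos_iff.2 hL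
  rw [← coeff_sq_ofDigits_X_middle rL hL]
  exact List.mem_map_of_mem (List.mem_range.2 (by omega))

theorem le_sum_sq_of_mem_convSquare {L : List ℕ} {c : ℕ} (hc : c ∈ convSquare L) :
    c ≤ (L.map (· ^ 2)).sum := by
  obtain ⟨j, -, rfl⟩ := List.mem_map.1 hc
  exact coeff_sq_ofDigits_X_le L j

/-! ### Decimal digits and the length of a palindromic square -/

theorem decimalDigits_ne_nil (m : ℕ) : decimalDigits m ≠ [] := by
  unfold decimalDigits
  split_ifs with h
  · simp
  · exact Nat.digits_ne_nil_iff_ne_zero.2 h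

theorem ofDigits_decimalDigits (m : ℕ) : Nat.ofDigits 10 (decimalDigits m) = m := by
  unfold decimalDigits
  split_ifs with h
  · simp [h]
  · exact Nat.ofDigits_digits 10 m

theorem lt_of_mem_decimalDigits {m x : ℕ} (h : x ∈ decimalDigits m) : x < 10 := by
  unfold decimalDigits at h
  split_ifs at h
  · simp at h; omega
  · exact Nat.digits_lt_base (by norm_num) h

theorem lt_pow_decimalLength (m : ℕ) : m < 10 ^ decimalLength m := by
  have := Nat.ofDigits_lt_base_pow_length (b := 10) (by norm_num)
    (fun x hx => lt_of_mem_decimalDigits (m := m) hx)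
  rwa [ofDigits_decimalDigits] at this

theorem decimalDigits_ofDigits {L : List ℕ} (hlt : ∀ x ∈ L, x < 10) (h : L ≠ [])
    (hlast : L.getLast h ≠ 0) : decimalDigits (Nat.ofDigits 10 L) = L := by
  have hd := Nat.digits_ofDigits 10 (by norm_num) L hlt (fun _ => hlast)
  have h0 : Nat.ofDigits 10 L ≠ 0 := by
    intro h0
    rw [h0] at hd
    exact h (by simpa using hd.symm)
  rw [decimalDigits, if_neg h0, hd]

theorem pow_le_of_decimalLength {m l : ℕ} (hm : m ≠ 0) (hl : decimalLength m = l + 1) :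
    10 ^ l ≤ m := by
  rw [decimalLength, decimalDigits, if_neg hm] at hl
  by_contra! h
  have := (Nat.digits_length_le_iff (b := 10) (by norm_num) (k := l) m).2 h
  omega

/-- A palindrome with `l + 1` digits and last digit `a` lies in `[a * 10 ^ l, (a + 1) * 10 ^ l)`. -/
theorem IsDecimalPalindrome.bounds {m l : ℕ} (h : IsDecimalPalindrome m)
    (hl : decimalLength m = l + 1) :
    m % 10 * 10 ^ l ≤ m ∧ m < (m % 10 + 1) * 10 ^ l := by
  have hm := ofDigits_decimalDigits m
  unfold decimalLength at hl
  have hlt : ∀ x ∈ decimalDigits m, x < 10 := fun x hx => lt_of_mem_decimalDigits hx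
  unfold IsDecimalPalindrome at h
  rcases hD : decimalDigits m with _ | ⟨a, T⟩
  · exact absurd hD (decimalDigits_ne_nil m)
  have ha : m % 10 = a := by
    rw [hD, Nat.ofDigits_cons] at hm
    have := hlt a (by simp [hD])
    omega
  rw [hD] at h hl hlt hm
  have h2 : T.reverse ++ [a] = a :: T := by simpa using h
  rw [← h2, Nat.ofDigits_append, Nat.ofDigits_singleton, List.length_reverse] at hm
  have h3 := Nat.ofDigits_lt_base_pow_length (b := 10) (l := T.reverse) (by norm_num)
    (fun x hx => hlt x (by simp at hx; simp [hx]))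
  rw [List.length_reverse] at h3
  have h4 : T.length = l := by simpa using hl
  rw [h4] at h3 hm
  rw [ha]
  rw [add_mul, one_mul, mul_comm a]
  constructor <;> omega

theorem decimalLength_pos (m : ℕ) : 0 < decimalLength m :=
  List.length_pos_iff.2 (decimalDigits_ne_nil m)

/-- If `k` and `k ^ 2` are palindromes, then `k ^ 2` has `2 * d - 1` digits where `d` is the
number of digits of `k`. -/
theorem decimalLength_sq {k : ℕ} (hk : IsDecimalPalindrome k) (hk2 : IsDecimalPalindrome (k ^ 2)) :
    decimalLength (k ^ 2) = 2 * decimalLength k - 1 := by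
  rcases Nat.eq_zero_or_pos k with rfl | hpos
  · simp [decimalLength, decimalDigits]
  obtain ⟨l, hl⟩ := Nat.exists_eq_succ_of_ne_zero (decimalLength_pos k).ne'
  obtain ⟨r, hr⟩ := Nat.exists_eq_succ_of_ne_zero (decimalLength_pos (k ^ 2)).ne'
  rw [Nat.succ_eq_add_one] at hl hr
  have hklo := pow_le_of_decimalLength hpos.ne' hl
  have hkhi := lt_pow_decimalLength k
  have hslo := pow_le_of_decimalLength (pow_pos hpos 2).ne' hr
  have hshi := lt_pow_decimalLength (k ^ 2)
  rw [hl] at hkhi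
  rw [hr] at hshi
  have h1 : 10 ^ (2 * l) < 10 ^ (r + 1) := by
    refine lt_of_le_of_lt ?_ hshi
    rw [mul_comm, pow_mul]
    exact Nat.pow_le_pow_left hklo 2
  have h2 : 10 ^ r < 10 ^ (2 * (l + 1)) := by
    refine lt_of_le_of_lt hslo ?_
    rw [mul_comm, pow_mul]
    exact Nat.pow_lt_pow_left hkhi (by norm_num)
  have h1' := (Nat.pow_lt_pow_iff_right (by norm_num : 1 < 10)).1 h1
  have h2' := (Nat.pow_lt_pow_iff_right (by norm_num : 1 < 10)).1 h2
  rw [hr, hl]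
  -- The only other possible length is `2 * l + 2`. Then the leading digit of `k ^ 2` would be its
  -- last digit `a ^ 2 % 10`, where `a` is both the first and last digit of `k`; comparing sizes
  -- excludes every `a`.
  by_contra hne
  have hrl : r = 2 * l + 1 := by omega
  subst hrl
  obtain ⟨b1, b2⟩ := hk.bounds hl
  obtain ⟨c1, c2⟩ := hk2.bounds hr
  have hmod : k ^ 2 % 10 = (k % 10) ^ 2 % 10 := Nat.pow_mod k 2 10
  rw [hmod] at c1 c2
  have ha : k % 10 < 10 := Nat.mod_lt _ (by norm_num)
  generalize k % 10 = a at *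
  have hp : 0 < 10 ^ l := by positivity
  have e : 10 ^ (2 * l + 1) = 10 * (10 ^ l) ^ 2 := by rw [pow_succ, mul_comm 2 l, pow_mul]; ring
  rw [e] at c1 c2
  generalize 10 ^ l = q at *
  have u1 : a ^ 2 < 10 * (a ^ 2 % 10 + 1) := by
    have := Nat.pow_le_pow_left b1 2
    have h3 : a ^ 2 * q ^ 2 < (10 * (a ^ 2 % 10 + 1)) * q ^ 2 := by nlinarith
    exact lt_of_mul_lt_mul_right h3 (Nat.zero_le _)
  have u2 : 10 * (a ^ 2 % 10) < (a + 1) ^ 2 := by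
    have := Nat.pow_lt_pow_left b2 (n := 2) (by norm_num)
    have h3 : 10 * (a ^ 2 % 10) * q ^ 2 < (a + 1) ^ 2 * q ^ 2 := by nlinarith
    exact lt_of_mul_lt_mul_right h3 (Nat.zero_le _)
  have ha0 : a ≠ 0 := by
    rintro rfl
    omega
  interval_cases a <;> omega

/-- The palindromic lists of length `d` whose entries have squares summing to at most `s`. -/
def palindromicLists (d s : ℕ) : Set (List ℕ) :=
  {L | L.length = d ∧ L.reverse = L ∧ (L.map (· ^ 2)).sum ≤ s}

/-! ### Squaring without carries -/

theorem sum_sq_decimalDigits_le {k : ℕ} (hk : IsDecimalPalindrome k)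
    (hk2 : IsDecimalPalindrome (k ^ 2)) : ((decimalDigits k).map (· ^ 2)).sum ≤ 9 := by
  have hlen := decimalLength_sq hk hk2
  have hC : convSquare (decimalDigits k) = decimalDigits (k ^ 2) :=
    Nat.eq_of_ofDigits_eq_of_reverse_eq (length_convSquare _) hlen (reverse_convSquare hk) hk2
      (fun _ hy => lt_of_mem_decimalDigits hy)
      (by rw [ofDigits_convSquare (decimalDigits_ne_nil k), ofDigits_decimalDigits,
        ofDigits_decimalDigits])
  have := sum_sq_mem_convSquare hk (decimalDigits_ne_nil k)
  rw [hC] at this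
  have := lt_of_mem_decimalDigits this
  omega

theorem decimalDigits_sq_ofDigits {L : List ℕ} (hL : L ≠ []) (rL : L.reverse = L)
    (hs : (L.map (· ^ 2)).sum ≤ 9) (h0 : L.head hL ≠ 0) :
    decimalDigits (Nat.ofDigits 10 L) = L ∧
      decimalDigits (Nat.ofDigits 10 L ^ 2) = convSquare L := by
  have hlast : L.getLast hL ≠ 0 := by
    rw [← List.head_reverse (by simpa using hL)]
    simpa only [rL] using h0
  have hlt : ∀ x ∈ L, x < 10 := by
    intro x hx
    have := List.single_le_sum (l := L.map (· ^ 2)) (by simp) (x ^ 2)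
      (List.mem_map_of_mem (f := (· ^ 2)) hx)
    nlinarith
  refine ⟨decimalDigits_ofDigits hlt hL hlast, ?_⟩
  have hpos := List.length_pos_iff.2 hL
  have hC : convSquare L ≠ [] := by
    rw [← List.length_pos_iff, length_convSquare]
    omega
  rw [← ofDigits_convSquare hL]
  refine decimalDigits_ofDigits (fun x hx => ?_) hC ?_
  · have := le_sum_sq_of_mem_convSquare hx
    omega
  -- By symmetry the last coefficient is the constant one, the square of the first entry of `L`.
  · rw [← List.head_reverse (by simpa using hC)]
    simp only [reverse_convSquare rL]
    rw [List.head_eq_getElem]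
    simp only [convSquare, List.getElem_map, List.getElem_range, Polynomial.coeff_zero_eq_eval_zero,
      Polynomial.eval_pow, Polynomial.eval_ofDigits_X]
    cases L with
    | nil => simp at hL
    | cons x L => simpa [Nat.ofDigits_cons] using h0

/-- Length `d = 1` is excluded because there `k = 0` has first digit zero. -/
theorem palindromicSquares_eq_image {d : ℕ} (hd : 2 ≤ d) :
    palindromicSquares (2 * d - 1) =
      (fun L => Nat.ofDigits 10 L ^ 2) '' {L ∈ palindromicLists d 9 | L.getD 0 0 ≠ 0} := by
  ext m
  constructor
  · rintro ⟨hl, hm, k, hk, rfl⟩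
    have hlen := decimalLength_sq hk hm
    have hkd : decimalLength k = d := by omega
    refine ⟨decimalDigits k, ⟨⟨hkd, hk, sum_sq_decimalDigits_le hk hm⟩, ?_⟩, ?_⟩
    · have hk0 : k ≠ 0 := by
        rintro rfl
        simp [decimalLength, decimalDigits] at hkd
        omega
      have hb := (hk.bounds (l := d - 1) (by omega)).2
      have hlo := pow_le_of_decimalLength (l := d - 1) hk0 (by omega)
      intro h0
      have hmod : k % 10 = (decimalDigits k).getD 0 0 := by
        rw [decimalDigits, if_neg hk0, Nat.getD_digits k 0 (by norm_num)]
        simp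
      rw [hmod, h0] at hb
      omega
    · simp only [ofDigits_decimalDigits]
  · rintro ⟨L, ⟨⟨hl, rL, hs⟩, h0⟩, rfl⟩
    have hL : L ≠ [] := by
      rw [← List.length_pos_iff]
      omega
    have h0' : L.head hL ≠ 0 := by
      cases L with
      | nil => simp at hL
      | cons x L => simpa using h0
    obtain ⟨h1, h2⟩ := decimalDigits_sq_ofDigits hL rL hs h0'
    refine ⟨?_, ?_, Nat.ofDigits 10 L, ?_, rfl⟩
    · rw [decimalLength, h2, length_convSquare, hl]
    · rw [IsDecimalPalindrome, h2, reverse_convSquare rL]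
    · rw [IsDecimalPalindrome, h1, rL]

theorem encard_palindromicSquares {d : ℕ} (hd : 2 ≤ d) :
    (palindromicSquares (2 * d - 1)).encard =
      {L ∈ palindromicLists d 9 | L.getD 0 0 ≠ 0}.encard := by
  rw [palindromicSquares_eq_image hd]
  refine Set.InjOn.encard_image ?_
  have key : ∀ L ∈ {L ∈ palindromicLists d 9 | L.getD 0 0 ≠ 0},
      decimalDigits (Nat.ofDigits 10 L) = L := by
    rintro L ⟨⟨hl, rL, hs⟩, h0⟩
    have hL : L ≠ [] := by
      rw [← List.length_pos_iff]
      omega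
    refine (decimalDigits_sq_ofDigits hL rL hs ?_).1
    cases L with
    | nil => simp at hL
    | cons x L => simpa using h0
  intro L hL M hM h
  have h' : Nat.ofDigits 10 L = Nat.ofDigits 10 M := Nat.pow_left_injective (n := 2) (by norm_num) h
  rw [← key L hL, ← key M hM, h']

/-! ### Counting palindromic lists by peeling off outer pairs -/

/-- The list `x, L, x`. -/
def wrapList (x : ℕ) (L : List ℕ) : List ℕ := x :: (L ++ [x])

theorem wrapList_injective (x : ℕ) : Function.Injective (wrapList x) := by
  intro L M h
  simpa [wrapList] using h

theorem wrapList_mem_palindromicLists {x d s : ℕ} {L : List ℕ} :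
    wrapList x L ∈ palindromicLists (d + 2) s ↔
      2 * x ^ 2 ≤ s ∧ L ∈ palindromicLists d (s - 2 * x ^ 2) := by
  simp only [palindromicLists, wrapList, Set.mem_ofPred_eq, List.length_cons, List.length_append,
    List.length_nil, List.reverse_cons, List.reverse_append, List.reverse_nil, List.nil_append,
    List.cons_append, List.map_cons, List.map_append, List.map_nil, List.sum_cons,
    List.sum_append, List.sum_nil, List.cons.injEq, true_and, List.append_left_inj]
  constructor
  · rintro ⟨h1, h2, h3⟩
    exact ⟨by omega, by omega, h2, by omega⟩
  · rintro ⟨h0, h1, h2, h3⟩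
    exact ⟨by omega, h2, by omega⟩

theorem disjoint_wrapList_image {x y : ℕ} (h : x ≠ y) (S T : Set (List ℕ)) :
    Disjoint (wrapList x '' S) (wrapList y '' T) := by
  rw [Set.disjoint_left]
  rintro _ ⟨L, -, rfl⟩ ⟨M, -, hM⟩
  simp only [wrapList, List.cons.injEq] at hM
  exact h hM.1.symm

theorem exists_wrapList_of_mem_palindromicLists {d s : ℕ} {L : List ℕ}
    (h : L ∈ palindromicLists (d + 2) s) : ∃ x M, L = wrapList x M := by
  obtain ⟨x, M, hL, -⟩ := List.exists_eq_cons_append_of_reverse_eq h.2.1 h.1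
  exact ⟨x, M, hL⟩

/-- An outer pair of 2s already contributes 8, so only 0 and 1 can occur outside. -/
theorem encard_palindromicLists_add_two {d s : ℕ} (h2 : 2 ≤ s) (h8 : s < 8) :
    (palindromicLists (d + 2) s).encard =
      (palindromicLists d s).encard + (palindromicLists d (s - 2)).encard := by
  have : palindromicLists (d + 2) s =
      wrapList 0 '' palindromicLists d s ∪ wrapList 1 '' palindromicLists d (s - 2) := by
    ext L
    constructor
    · intro hL
      obtain ⟨x, M, rfl⟩ := exists_wrapList_of_mem_palindromicLists hL
      rw [wrapList_mem_palindromicLists] at hL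
      have hx : x < 2 := by nlinarith
      interval_cases x
      · exact Or.inl ⟨M, by simpa using hL.2, rfl⟩
      · exact Or.inr ⟨M, by simpa using hL.2, rfl⟩
    · rintro (⟨M, hM, rfl⟩ | ⟨M, hM, rfl⟩) <;> rw [wrapList_mem_palindromicLists]
      · simpa using hM
      · exact ⟨by omega, by simpa using hM⟩
  rw [this, Set.encard_union_eq (disjoint_wrapList_image (by norm_num) _ _),
    (wrapList_injective _).encard_image, (wrapList_injective _).encard_image]

theorem encard_palindromicLists_add_two_one (d : ℕ) :
    (palindromicLists (d + 2) 1).encard = (palindromicLists d 1).encard := by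
  have : palindromicLists (d + 2) 1 = wrapList 0 '' palindromicLists d 1 := by
    ext L
    constructor
    · intro hL
      obtain ⟨x, M, rfl⟩ := exists_wrapList_of_mem_palindromicLists hL
      rw [wrapList_mem_palindromicLists] at hL
      have hx : x < 1 := by nlinarith
      interval_cases x
      exact ⟨M, by simpa using hL.2, rfl⟩
    · rintro ⟨M, hM, rfl⟩
      rw [wrapList_mem_palindromicLists]
      simpa using hM
  rw [this, (wrapList_injective _).encard_image]

theorem encard_palindromicLists_nine_head_ne_zero (d : ℕ) :
    {L ∈ palindromicLists (d + 2) 9 | L.getD 0 0 ≠ 0}.encard =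
      (palindromicLists d 7).encard + (palindromicLists d 1).encard := by
  have : {L ∈ palindromicLists (d + 2) 9 | L.getD 0 0 ≠ 0} =
      wrapList 1 '' palindromicLists d 7 ∪ wrapList 2 '' palindromicLists d 1 := by
    ext L
    constructor
    · rintro ⟨hL, h0⟩
      obtain ⟨x, M, rfl⟩ := exists_wrapList_of_mem_palindromicLists hL
      rw [wrapList_mem_palindromicLists] at hL
      have hx : x < 3 := by nlinarith
      interval_cases x
      · simp [wrapList] at h0
      · exact Or.inl ⟨M, by simpa using hL.2, rfl⟩
      · exact Or.inr ⟨M, by simpa using hL.2, rfl⟩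
    · rintro (⟨M, hM, rfl⟩ | ⟨M, hM, rfl⟩) <;>
        exact ⟨wrapList_mem_palindromicLists.2 ⟨by norm_num, by simpa using hM⟩, by simp [wrapList]⟩
  rw [this, Set.encard_union_eq (disjoint_wrapList_image (by norm_num) _ _),
    (wrapList_injective _).encard_image, (wrapList_injective _).encard_image]

theorem encard_palindromicLists_zero (s : ℕ) : (palindromicLists 0 s).encard = 1 := by
  have : palindromicLists 0 s = {[]} := by
    ext L
    simp only [palindromicLists, List.length_eq_zero_iff, Set.mem_ofPred_eq, Set.mem_singleton_iff]
    exact ⟨fun h => h.1, by rintro rfl; simp⟩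
  rw [this, Set.encard_singleton]

theorem encard_palindromicLists_one {s r : ℕ} (hr : r ^ 2 ≤ s) (hr' : s < (r + 1) ^ 2) :
    (palindromicLists 1 s).encard = ((r + 1 : ℕ) : ℕ∞) := by
  have : palindromicLists 1 s = (fun x => [x]) '' (Finset.range (r + 1) : Set ℕ) := by
    ext L
    simp only [palindromicLists, List.length_eq_one_iff, Set.mem_ofPred_eq, Set.mem_image,
      Finset.mem_coe, Finset.mem_range]
    constructor
    · rintro ⟨⟨x, rfl⟩, -, h⟩
      refine ⟨x, ?_, rfl⟩
      simp only [List.map_cons, List.map_nil, List.sum_cons, List.sum_nil, add_zero] at h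
      exact lt_of_pow_lt_pow_left₀ 2 (by omega) (lt_of_le_of_lt h hr')
    · rintro ⟨x, hx, rfl⟩
      refine ⟨⟨x, rfl⟩, rfl, ?_⟩
      simp only [List.map_cons, List.map_nil, List.sum_cons, List.sum_nil, add_zero]
      exact (Nat.pow_le_pow_left (by omega) 2).trans hr
  rw [this, Function.Injective.encard_image (fun _ _ h => by simpa using h),
    Set.encard_coe_eq_coe_finsetCard, Finset.card_range]

/-- Each of the `h` mirror pairs is 0 or 1, and a bound `2 * j + 1` allows at most `j` pairs of 1s.
-/
theorem encard_palindromicLists_even (h : ℕ) :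
    (palindromicLists (2 * h) 1).encard = ((1 : ℕ) : ℕ∞) ∧
    (palindromicLists (2 * h) 3).encard = ((1 + h : ℕ) : ℕ∞) ∧
    (palindromicLists (2 * h) 5).encard = ((1 + h + h.choose 2 : ℕ) : ℕ∞) ∧
    (palindromicLists (2 * h) 7).encard = ((1 + h + h.choose 2 + h.choose 3 : ℕ) : ℕ∞) := by
  induction h with
  | zero => simp [encard_palindromicLists_zero]
  | succ h ih =>
    obtain ⟨h1, h3, h5, h7⟩ := ih
    have c2 : (h + 1).choose 2 = h + h.choose 2 := by rw [Nat.choose_succ_succ' h 1]; simp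
    have c3 : (h + 1).choose 3 = h.choose 2 + h.choose 3 := Nat.choose_succ_succ' h 2
    rw [show 2 * (h + 1) = 2 * h + 2 by ring, encard_palindromicLists_add_two_one,
      encard_palindromicLists_add_two (by norm_num) (by norm_num),
      encard_palindromicLists_add_two (by norm_num) (by norm_num),
      encard_palindromicLists_add_two (by norm_num) (by norm_num)]
    norm_num only
    rw [h1, h3, h5, h7, c2, c3]
    refine ⟨rfl, ?_, ?_, ?_⟩ <;> norm_cast <;> ring

/-- A middle entry 0 or 1 leaves the same number of allowed pairs as in the even case, whence the
factors 2; a middle 2 costs 4 and adds 1 for bound 5 and `1 + h` for bound 7. -/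
theorem encard_palindromicLists_odd (h : ℕ) :
    (palindromicLists (2 * h + 1) 1).encard = ((2 : ℕ) : ℕ∞) ∧
    (palindromicLists (2 * h + 1) 3).encard = ((2 + 2 * h : ℕ) : ℕ∞) ∧
    (palindromicLists (2 * h + 1) 5).encard = ((3 + 2 * h + 2 * h.choose 2 : ℕ) : ℕ∞) ∧
    (palindromicLists (2 * h + 1) 7).encard =
      ((3 + 3 * h + 2 * h.choose 2 + 2 * h.choose 3 : ℕ) : ℕ∞) := by
  induction h with
  | zero =>
    refine ⟨?_, ?_, ?_, ?_⟩
    · exact encard_palindromicLists_one (r := 1) (by norm_num) (by norm_num)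
    · exact encard_palindromicLists_one (r := 1) (by norm_num) (by norm_num)
    · exact encard_palindromicLists_one (r := 2) (by norm_num) (by norm_num)
    · exact encard_palindromicLists_one (r := 2) (by norm_num) (by norm_num)
  | succ h ih =>
    obtain ⟨h1, h3, h5, h7⟩ := ih
    have c2 : (h + 1).choose 2 = h + h.choose 2 := by rw [Nat.choose_succ_succ' h 1]; simp
    have c3 : (h + 1).choose 3 = h.choose 2 + h.choose 3 := Nat.choose_succ_succ' h 2
    rw [show 2 * (h + 1) + 1 = 2 * h + 1 + 2 by ring, encard_palindromicLists_add_two_one,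
      encard_palindromicLists_add_two (by norm_num) (by norm_num),
      encard_palindromicLists_add_two (by norm_num) (by norm_num),
      encard_palindromicLists_add_two (by norm_num) (by norm_num)]
    norm_num only
    rw [h1, h3, h5, h7, c2, c3]
    refine ⟨rfl, ?_, ?_, ?_⟩ <;> norm_cast <;> ring

/-! ### The terms of the sequence -/

theorem a307717_zero : a307717 0 = 4 := by
  have hsmall : ∀ m < 10, decimalDigits m = [m] := by
    intro m hm
    interval_cases m <;> simp [decimalDigits]
  have : palindromicSquares (0 + 1) = (({0, 1, 4, 9} : Finset ℕ) : Set ℕ) := by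
    ext m
    simp only [Finset.coe_insert, Finset.coe_singleton, Set.mem_insert_iff, Set.mem_singleton_iff]
    constructor
    · rintro ⟨hl, -, k, -, rfl⟩
      have := lt_pow_decimalLength (k ^ 2)
      rw [hl] at this
      norm_num at this
      have hk : k < 4 := by nlinarith
      interval_cases k <;> simp
    · have aux : ∀ k < 4, k ^ 2 ∈ palindromicSquares (0 + 1) := by
        intro k hk
        have hk2 : k ^ 2 < 10 := by nlinarith
        refine ⟨?_, ?_, k, ?_, rfl⟩
        · simp [decimalLength, hsmall _ hk2]
        · simp [IsDecimalPalindrome, hsmall _ hk2]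
        · simp [IsDecimalPalindrome, hsmall k (by omega)]
      rintro (rfl | rfl | rfl | rfl)
      · exact aux 0 (by norm_num)
      · exact aux 1 (by norm_num)
      · exact aux 2 (by norm_num)
      · exact aux 3 (by norm_num)
  rw [a307717, this, Set.ncard_coe_finset]
  rfl

theorem a307717_odd (n : ℕ) : a307717 (2 * n + 1) = 0 := by
  have : palindromicSquares (2 * n + 1 + 1) = ∅ := by
    rw [Set.eq_empty_iff_forall_notMem]
    rintro _ ⟨hl, hm, k, hk, rfl⟩
    have := decimalLength_sq hk hm
    have := decimalLength_pos k
    omega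
  rw [a307717, this, Set.ncard_empty]

theorem a307717_two_mul_add_two (d : ℕ) :
    a307717 (2 * (d + 1)) =
      ((palindromicLists d 7).encard + (palindromicLists d 1).encard).toNat := by
  rw [a307717, Set.ncard, show 2 * (d + 1) + 1 = 2 * (d + 2) - 1 by omega,
    encard_palindromicSquares (by omega), encard_palindromicLists_nine_head_ne_zero]

theorem Nat.cast_choose_three (h : ℕ) : (h.choose 3 : ℚ) = h * (h - 1) * (h - 2) / 6 := by
  induction h with
  | zero => simp
  | succ h ih =>
    rw [Nat.choose_succ_succ' h 2]
    push_cast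
    rw [ih, Nat.cast_choose_two]
    ring

theorem theorem1 :
    a307717 0 = 4 ∧
    (∀ n : ℕ, a307717 (2 * n + 1) = 0) ∧
    (∀ n : ℕ, 1 ≤ n →
      (a307717 (2 * n) : ℚ) =
        (((-1 : ℚ) ^ n + 3) * (n : ℚ) ^ 3 - (9 * (-1 : ℚ) ^ n + 15) * (n : ℚ) ^ 2
          + (65 * (-1 : ℚ) ^ n + 111) * (n : ℚ) + 21 * (-1 : ℚ) ^ n + 171) / 96) := by
  refine ⟨a307717_zero, a307717_odd, fun n hn => ?_⟩
  obtain ⟨d, rfl⟩ := Nat.exists_eq_add_of_le' hn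
  rw [a307717_two_mul_add_two]
  -- Here `d = n - 1` counts the inner digits of `k`, so its parity is opposite to that of `n`.
  obtain ⟨h, rfl | rfl⟩ := Nat.even_or_odd' d
  · obtain ⟨h1, -, -, h7⟩ := encard_palindromicLists_even h
    have e : (-1 : ℚ) ^ (2 * h + 1) = -1 := Odd.neg_one_pow ⟨h, rfl⟩
    rw [h1, h7, e, ← Nat.cast_add, ENat.toNat_natCast]
    push_cast
    rw [Nat.cast_choose_three, Nat.cast_choose_two]
    ring
  · obtain ⟨h1, -, -, h7⟩ := encard_palindromicLists_odd h
    have e : (-1 : ℚ) ^ (2 * h + 1 + 1) = 1 := Even.neg_one_pow ⟨h + 1, by ring⟩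
    rw [h1, h7, e, ← Nat.cast_add, ENat.toNat_natCast]
    push_cast
    rw [Nat.cast_choose_three, Nat.cast_choose_two]
    ring
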